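/- **Setting.** A *preordered group* is a pair $(G,P_G)$ where $G$ is a (not necessarily commutative) group, written additively, and $P_G\subseteq G$ (the *positive cone*) is a submonoid closed under conjugation. A morphism $(f,\bar f)\colon (G,P_G)\to(H,P_H)$ is a group homomorphism $f\colon G\to H$ with $f(P_G)\subseteq P_H$, and $\bar f\colon P_G\to P_H$ denotes its restriction. Let $\mathsf{PreOrdGrp}$ be the resulting category, $\mathsf{PreOrdAb}$ its full subcategory of those $(G,P_G)$ with $G$ abelian, and $\mathsf{Mono(Ab)}$ the full subcategory of those $(G,P_G)$ with $G$ abelian and $P_G$ a subgroup of $G$ (equivalently, the category of monomorphisms of abelian groups). The inclusion $U\colon\mathsf{Mono(Ab)}\to\mathsf{PreOrdGrp}$ has the left adjoint $F=A\circ C$, where $C(G,P_G)=(G/[G,G],\eta_G(P_G))$, with $\eta_G\colon G\to G/[G,G]$ the quotient map, is the reflector onto $\mathsf{PreOrdAb}$, and $A(G,P_G)=(G,\mathrm{grp}(P_G))$, with $\mathrm{grp}(P_G)=\{a-b\mid a,b\in P_G\}$ the group completion of $P_G$, is the reflector of $\mathsf{PreOrdAb}$ onto $\mathsf{Mono(Ab)}$.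 Write $\eta$ also for the unit of $F\dashv U$. Let $\Gamma=(\mathsf{PreOrdGrp},\mathsf{Mono(Ab)},F,U,\mathscr E,\mathscr Z)$ be the Galois structure in which $\mathscr E$ and $\mathscr Z$ are the classes of regular epimorphisms of $\mathsf{PreOrdGrp}$ and $\mathsf{Mono(Ab)}$. A morphism $g\colon X\to Y$ in $\mathscr E$ is a *$\Gamma$-trivial extension* if the naturality square with sides $\eta_X$, $g$, $UF(g)$, $\eta_Y$ is a pullback. A *monadic extension* is a morphism $p\colon E\to B$ in $\mathscr E$ that is an effective descent morphism, i.e. the change-of-base functor $p^*\colon \mathsf{PreOrdGrp}\downarrow B\to\mathsf{PreOrdGrp}\downarrow E$ is monadic. A morphism $g\colon X\to Y$ in $\mathscr E$ is *$\Gamma$-central* if there is a monadic extension $p\colon E\to Y$ such that the pullback $p^*(g)\colon E\times_Y X\to E$ is a $\Gamma$-trivial extension; it is *$\Gamma$-normal* if $g$ is itself a monadic extension and $g^*(g)$, the first projection of its kernel pair, is a $\Gamma$-trivial extension. A surjective monoid homomorphism $h\colon M\to N$, with kernel pair $\mathrm{Eq}(h)=\{(x,y)\in M\times M\mid h(x)=h(y)\}$,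 first projection $\pi_1\colon\mathrm{Eq}(h)\to M$ and diagonal $\Delta\colon M\to\mathrm{Eq}(h)$, is a *special homogeneous surjection* if for every $x\in M$ both maps $\mathrm{Ker}(\pi_1)\to\pi_1^{-1}(x)$, $k\mapsto k+\Delta(x)$ and $k\mapsto\Delta(x)+k$, are bijective. **Theorem.** Let $(f,\bar f)\colon(G,P_G)\to(H,P_H)$ be a regular epimorphism in $\mathsf{PreOrdGrp}$. The following conditions are equivalent: 1. (a) $\mathrm{Ker}(f)\subseteq Z(G)$, and (b) $\bar f$ is a special homogeneous surjection of monoids; 2. $(f,\bar f)$ is a $\Gamma$-normal extension; 3. $(f,\bar f)$ is a $\Gamma$-central extension. -/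

import Mathlib

open CategoryTheory CategoryTheory.Limits

universe v₁ v₂ u₁ u₂ u

/-! ### Galois structures in the sense of categorical Galois theory -/

/-- A Galois structure `(C, F, L, R, E, Z)`: an adjunction `L ⊣ R` between `C` and `F` together with
classes of morphisms `E` in `C` and `Z` in `F`, each admitting pullbacks along its members, closed
under composition, containing the isomorphisms and pullback-stable, with `L(E) ⊆ Z` and
`R(Z) ⊆ E`. -/
structure GaloisStructure (C : Type u₁) [Category.{v₁} C] (F : Type u₂) [Category.{v₂} F] where
  left : C ⥤ F
  right : F ⥤ C
  adj : left ⊣ right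
  E : MorphismProperty C
  Z : MorphismProperty F
  hasPullbacksAlong_E : ∀ ⦃A B : C⦄ (f : A ⟶ B), E f → HasPullbacksAlong f
  hasPullbacksAlong_Z : ∀ ⦃A B : F⦄ (f : A ⟶ B), Z f → HasPullbacksAlong f
  comp_E : E.IsStableUnderComposition
  comp_Z : Z.IsStableUnderComposition
  iso_E : MorphismProperty.isomorphisms C ≤ E
  iso_Z : MorphismProperty.isomorphisms F ≤ Z
  baseChange_E : E.IsStableUnderBaseChange
  baseChange_Z : Z.IsStableUnderBaseChange
  left_map : ∀ ⦃A B : C⦄ (f : A ⟶ B), E f → Z (left.map f)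
  right_map : ∀ ⦃A B : F⦄ (f : A ⟶ B), Z f → E (right.map f)

/-- `p : X ⟶ B` is an effective descent morphism if pullbacks along `p` exist and the change-of-base
functor `C ↓ B ⥤ C ↓ X` is monadic. -/
def IsEffectiveDescentMorphism {C : Type u₁} [Category.{v₁} C] {X B : C} (p : X ⟶ B) : Prop :=
  ∃ _ : HasPullbacksAlong p, Nonempty (MonadicRightAdjoint (Over.pullback p))

namespace GaloisStructure

variable {C : Type u₁} [Category.{v₁} C] {F : Type u₂} [Category.{v₂} F]

/-- An extension `f` is trivial if the naturality square of the unit at `f` is a pullback. -/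
def IsTrivialExtension (Γ : GaloisStructure C F) {A B : C} (f : A ⟶ B) : Prop :=
  Γ.E f ∧ IsPullback (Γ.adj.unit.app A) f (Γ.right.map (Γ.left.map f)) (Γ.adj.unit.app B)

/-- A monadic extension is an extension that is an effective descent morphism. -/
def IsMonadicExtension (Γ : GaloisStructure C F) {X B : C} (p : X ⟶ B) : Prop :=
  Γ.E p ∧ IsEffectiveDescentMorphism p

/-- An extension `f` is central if there are a monadic extension `p` and a pullback
`π₁ = p^*(f)` of `f` along `p` that is a trivial extension. -/
def IsCentralExtension (Γ : GaloisStructure C F) {A B : C} (f : A ⟶ B) : Prop :=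
  Γ.E f ∧ ∃ (X : C) (p : X ⟶ B), Γ.IsMonadicExtension p ∧
    ∃ (P : C) (π₁ : P ⟶ X) (π₂ : P ⟶ A), IsPullback π₂ π₁ f p ∧ Γ.IsTrivialExtension π₁

/-- A morphism `f` is a normal extension if it is a monadic extension and the first
projection `f^*(f)` of its kernel pair is a trivial extension. -/
def IsNormalExtension (Γ : GaloisStructure C F) {A B : C} (f : A ⟶ B) : Prop :=
  Γ.IsMonadicExtension f ∧
    ∃ (P : C) (π₁ π₂ : P ⟶ A), IsPullback π₂ π₁ f f ∧ Γ.IsTrivialExtension π₁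

end GaloisStructure

/-! ### Special homogeneous surjections of monoids -/

/-- A split epimorphism `f : X →* Y` of monoids with section `s` is homogeneous if, for every `y`,
the maps `k ↦ k * s y` and `k ↦ s y * k` are bijections from the kernel of `f` onto the
fibre of `f` over `y`. -/
structure IsHomogeneousSplitEpi {X Y : Type*} [Monoid X] [Monoid Y] (f : X →* Y) (s : Y →* X) :
    Prop where
  section_comp : ∀ y, f (s y) = y
  bijOn_mul_right : ∀ y, Set.BijOn (fun k => k * s y) (MonoidHom.mker f : Set X) (f ⁻¹' {y})
  bijOn_mul_left : ∀ y, Set.BijOn (fun k => s y * k) (MonoidHom.mker f : Set X) (f ⁻¹' {y})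

/-- The kernel pair `Eq(f)` of a monoid homomorphism, as a submonoid of `X × X`. -/
def monoidKernelPair {X Y : Type*} [Monoid X] [Monoid Y] (f : X →* Y) : Submonoid (X × X) :=
  MonoidHom.eqLocusM (f.comp (MonoidHom.fst X X)) (f.comp (MonoidHom.snd X X))

/-- The first projection of the kernel pair. -/
def monoidKernelPairFst {X Y : Type*} [Monoid X] [Monoid Y] (f : X →* Y) :
    monoidKernelPair f →* X :=
  (MonoidHom.fst X X).comp (monoidKernelPair f).subtype

/-- The diagonal of the kernel pair. -/
def monoidKernelPairDiag {X Y : Type*} [Monoid X] [Monoid Y] (f : X →* Y) :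
    X →* monoidKernelPair f :=
  ((MonoidHom.id X).prod (MonoidHom.id X)).codRestrict (monoidKernelPair f) fun _ => rfl

/-- A surjective monoid homomorphism is a special homogeneous surjection if the first projection of
its kernel pair, with the diagonal as section, is a homogeneous split epimorphism. -/
def IsSpecialHomogeneousSurjection {X Y : Type*} [Monoid X] [Monoid Y] (f : X →* Y) : Prop :=
  Function.Surjective f ∧ IsHomogeneousSplitEpi (monoidKernelPairFst f) (monoidKernelPairDiag f)

/-! ### The category of preordered groups -/

/-- A preordered group: a (not necessarily commutative) group, written multiplicatively, with its
positive cone, a submonoid closed under conjugation. -/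
structure PreOrdGrp : Type (u + 1) where
  carrier : Type u
  [group : Group carrier]
  cone : Submonoid carrier
  conj_mem : ∀ (g : carrier) {x : carrier}, x ∈ cone → g * x * g⁻¹ ∈ cone

namespace PreOrdGrp

instance : CoeSort PreOrdGrp.{u} (Type u) := ⟨PreOrdGrp.carrier⟩

instance (G : PreOrdGrp.{u}) : Group G := G.group

/-- A morphism of preordered groups: a group homomorphism that restricts to the positive cones. -/
@[ext]
structure Hom (G H : PreOrdGrp.{u}) where
  hom : G →* H
  map_cone : ∀ {x : G}, x ∈ G.cone → hom x ∈ H.cone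

instance : Category PreOrdGrp.{u} where
  Hom G H := Hom G H
  id G := ⟨MonoidHom.id G, fun h => h⟩
  comp f g := ⟨g.hom.comp f.hom, fun h => g.map_cone (f.map_cone h)⟩

variable {G H K : PreOrdGrp.{u}}

/-- The restriction `f̄` of a morphism to the positive cones. -/
def Hom.coneMap (f : G ⟶ H) : G.cone →* H.cone :=
  (f.hom.comp G.cone.subtype).codRestrict H.cone fun x => f.map_cone x.2

theorem hom_ext' {f g : G ⟶ H} (h : ∀ x, f.hom x = g.hom x) : f = g :=
  Hom.ext (MonoidHom.ext h)

@[simp] theorem id_apply (x : G) : Hom.hom (𝟙 G) x = x := rfl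

@[simp] theorem comp_apply (f : G ⟶ H) (g : H ⟶ K) (x : G) :
    Hom.hom (f ≫ g) x = g.hom (f.hom x) := rfl

theorem congr_hom {f g : G ⟶ H} (h : f = g) (x : G) : f.hom x = g.hom x := by rw [h]

/-- The componentwise pullback of preordered groups. -/
def pb (f : G ⟶ K) (g : H ⟶ K) : PreOrdGrp.{u} where
  carrier := MonoidHom.eqLocus (f.hom.comp (MonoidHom.fst G H)) (g.hom.comp (MonoidHom.snd G H))
  cone := (G.cone.prod H.cone).comap (Subgroup.subtype _)
  conj_mem a _ hx := ⟨G.conj_mem a.1.1 hx.1, H.conj_mem a.1.2 hx.2⟩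

/-- First projection. -/
def pbFst (f : G ⟶ K) (g : H ⟶ K) : pb f g ⟶ G :=
  ⟨(MonoidHom.fst G H).comp (Subgroup.subtype _), fun h => h.1⟩

/-- Second projection. -/
def pbSnd (f : G ⟶ K) (g : H ⟶ K) : pb f g ⟶ H :=
  ⟨(MonoidHom.snd G H).comp (Subgroup.subtype _), fun h => h.2⟩

theorem pb_condition (f : G ⟶ K) (g : H ⟶ K) : pbFst f g ≫ f = pbSnd f g ≫ g :=
  hom_ext' fun x => x.2

/-- The map into the pullback. -/
def pbLift (f : G ⟶ K) (g : H ⟶ K) {T : PreOrdGrp.{u}} (a : T ⟶ G) (b : T ⟶ H)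
    (w : a ≫ f = b ≫ g) : T ⟶ pb f g :=
  ⟨(a.hom.prod b.hom).codRestrict _ fun x => congr_hom w x, fun h => ⟨a.map_cone h, b.map_cone h⟩⟩

theorem isPullback_pb (f : G ⟶ K) (g : H ⟶ K) : IsPullback (pbFst f g) (pbSnd f g) f g :=
  ⟨⟨pb_condition f g⟩, ⟨PullbackCone.IsLimit.mk _
    (fun s => pbLift f g s.fst s.snd s.condition) (fun _ => rfl) (fun _ => rfl)
    (fun _ _ h₁ h₂ => hom_ext' fun x =>
      Subtype.ext (Prod.ext (congr_hom h₁ x) (congr_hom h₂ x)))⟩⟩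

instance : HasPullbacks PreOrdGrp.{u} :=
  have : ∀ {X Y Z : PreOrdGrp.{u}} {f : X ⟶ Z} {g : Y ⟶ Z}, HasLimit (cospan f g) :=
    fun {_ _ _ f g} => (isPullback_pb f g).hasPullback
  hasPullbacks_of_hasLimit_cospan _

/-- The image of a morphism, with the image of the cone as its cone. -/
def im (f : G ⟶ H) : PreOrdGrp.{u} where
  carrier := f.hom.range
  cone := G.cone.map f.hom.rangeRestrict
  conj_mem := by
    rintro ⟨_, g, rfl⟩ _ ⟨x, hx, rfl⟩
    exact ⟨g * x * g⁻¹, G.conj_mem g hx, by simp; rfl⟩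

/-- The corestriction to the image. -/
def toIm (f : G ⟶ H) : G ⟶ im f := ⟨f.hom.rangeRestrict, fun {x} h => ⟨x, h, rfl⟩⟩

/-- The inclusion of the image. -/
def ofIm (f : G ⟶ H) : im f ⟶ H :=
  ⟨f.hom.range.subtype, by rintro _ ⟨x, hx, rfl⟩; exact f.map_cone hx⟩

/-- Both `f` and its restriction to the cones are surjective. -/
def IsSurj (f : G ⟶ H) : Prop :=
  Function.Surjective f.hom ∧ ∀ y ∈ H.cone, ∃ x ∈ G.cone, f.hom x = y

theorem IsSurj.exists_desc {f : G ⟶ H} (hf : IsSurj f) (k : G ⟶ K)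
    (h : pbFst f f ≫ k = pbSnd f f ≫ k) : ∃ d : H ⟶ K, f ≫ d = k := by
  have hk : ∀ x y : G, f.hom x = f.hom y → k.hom x = k.hom y := fun x y e =>
    congr_hom h (⟨(x, y), e⟩ : pb f f)
  let d : H →* K := f.hom.liftOfSurjective hf.1 ⟨k.hom, fun x hx => by
    have := hk x 1 (by rw [map_one]; exact hx)
    rw [map_one] at this
    exact this⟩
  have hd : ∀ x, d (f.hom x) = k.hom x := fun x =>
    MonoidHom.liftOfRightInverse_comp_apply _ _ _ _ x
  refine ⟨⟨d, ?_⟩, hom_ext' hd⟩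
  intro y hy
  obtain ⟨x, hx, rfl⟩ := hf.2 y hy
  rw [hd]
  exact k.map_cone hx

theorem IsSurj.cancel {f : G ⟶ H} (hf : IsSurj f) {a b : H ⟶ K} (h : f ≫ a = f ≫ b) : a = b :=
  hom_ext' fun y => by
    obtain ⟨x, rfl⟩ := hf.1 y
    exact congr_hom h x

theorem isSurj_of_section {f : G ⟶ H} (d : H ⟶ im f) (h : d ≫ ofIm f = 𝟙 H) : IsSurj f := by
  refine ⟨fun y => ?_, fun y hy => ?_⟩
  · obtain ⟨x, hx⟩ := (d.hom y).2
    exact ⟨x, hx.trans (congr_hom h y)⟩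
  · obtain ⟨x, hx, e⟩ := d.map_cone hy
    exact ⟨x, hx, (congrArg Subtype.val e).trans (congr_hom h y)⟩

theorem ofIm_cancel (f : G ⟶ H) {a b : K ⟶ im f} (h : a ≫ ofIm f = b ≫ ofIm f) : a = b :=
  hom_ext' fun x => Subtype.ext (congr_hom h x)

theorem isRegularEpi_iff (f : G ⟶ H) : IsRegularEpi f ↔ IsSurj f := by
  constructor
  · rintro ⟨⟨r⟩⟩
    have : Epi f := RegularEpi.epi f r
    have w : r.left ≫ toIm f = r.right ≫ toIm f := ofIm_cancel f r.w
    let d : H ⟶ im f := r.isColimit.desc (Cofork.ofπ (toIm f) w)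
    have hd : f ≫ d = toIm f := r.isColimit.fac (Cofork.ofπ (toIm f) w) WalkingParallelPair.one
    refine isSurj_of_section d ((cancel_epi f).1 ?_)
    rw [← Category.assoc, hd, Category.comp_id]
    rfl
  · intro hf
    exact ⟨⟨{ W := pb f f, left := pbFst f f, right := pbSnd f f, w := pb_condition f f
              isColimit := Cofork.IsColimit.mk _
                (fun s => (hf.exists_desc s.π s.condition).choose)
                (fun s => (hf.exists_desc s.π s.condition).choose_spec)
                (fun s m hm => hf.cancel
                  (hm.trans (hf.exists_desc s.π s.condition).choose_spec.symm)) }⟩⟩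

theorem IsSurj.comp {f : G ⟶ H} {g : H ⟶ K} (hf : IsSurj f) (hg : IsSurj g) :
    IsSurj (f ≫ g) := by
  refine ⟨hg.1.comp hf.1, fun z hz => ?_⟩
  obtain ⟨y, hy, rfl⟩ := hg.2 z hz
  obtain ⟨x, hx, rfl⟩ := hf.2 y hy
  exact ⟨x, hx, rfl⟩

theorem isSurj_of_isIso (f : G ⟶ H) [IsIso f] : IsSurj f := by
  have h : ∀ y, f.hom ((inv f).hom y) = y := congr_hom (IsIso.inv_hom_id f)
  exact ⟨fun y => ⟨_, h y⟩, fun y hy => ⟨_, (inv f).map_cone hy, h y⟩⟩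

/-- Surjectivity is stable under pullback. -/
theorem IsSurj.of_isPullback {P : PreOrdGrp.{u}} {p : P ⟶ G} {q : P ⟶ H} {f : G ⟶ K} {g : H ⟶ K}
    (sq : IsPullback p q f g) (hf : IsSurj f) : IsSurj q := by
  have h : (sq.isoIsPullback _ _ (isPullback_pb f g)).hom ≫ pbSnd f g = q := by simp
  rw [← h]
  refine (isSurj_of_isIso _).comp ⟨fun y => ?_, fun y hy => ?_⟩
  · obtain ⟨x, hx⟩ := hf.1 (g.hom y)
    exact ⟨⟨(x, y), hx⟩, rfl⟩
  · obtain ⟨x, hx, e⟩ := hf.2 (g.hom y) (g.map_cone hy)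
    exact ⟨⟨(x, y), e⟩, ⟨hx, hy⟩, rfl⟩

/-! ### Preordered abelian groups and monomorphisms of abelian groups -/

/-- Preordered groups whose group is abelian. -/
def isPreOrdAb : ObjectProperty PreOrdGrp.{u} := fun G => ∀ x y : G, x * y = y * x

/-- Preordered groups whose group is abelian and whose cone is a subgroup. -/
def isMonoAb : ObjectProperty PreOrdGrp.{u} := fun G =>
  (∀ x y : G, x * y = y * x) ∧ ∀ x ∈ G.cone, x⁻¹ ∈ G.cone

theorem isMonoAb_le : isMonoAb.{u} ≤ isPreOrdAb.{u} := fun _ h => h.1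

/-- The category of preordered abelian groups. -/
abbrev PreOrdAb : Type (u + 1) := isPreOrdAb.{u}.FullSubcategory

/-- The category of monomorphisms of abelian groups `P ↪ G`, realised as the full subcategory of
abelian objects of `PreOrdGrp`. -/
abbrev MonoAb : Type (u + 1) := isMonoAb.{u}.FullSubcategory

/-- The inclusion of preordered abelian groups in preordered groups. -/
abbrev functorV : PreOrdAb.{u} ⥤ PreOrdGrp.{u} := isPreOrdAb.ι

/-- The inclusion of monomorphisms of abelian groups in preordered abelian groups. -/
abbrev functorW : MonoAb.{u} ⥤ PreOrdAb.{u} := ObjectProperty.ιOfLE isMonoAb_le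

/-- The abelianization `G/[G,G]` with the direct image of the cone. -/
def abelianize (G : PreOrdGrp.{u}) : PreOrdGrp.{u} where
  carrier := Abelianization G
  cone := G.cone.map Abelianization.of
  conj_mem g x hx := by rwa [mul_comm g x, mul_inv_cancel_right]

/-- The functor `C`, sending `(G, P)` to `(G/[G,G], η(P))`. -/
def functorC : PreOrdGrp.{u} ⥤ PreOrdAb.{u} where
  obj G := ⟨abelianize G, fun x y => mul_comm (G := Abelianization G) x y⟩
  map {G H} f := ObjectProperty.homMk ⟨Abelianization.map f.hom, by
    rintro _ ⟨x, hx, rfl⟩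
    exact ⟨f.hom x, f.map_cone hx, rfl⟩⟩
  map_id G := by
    apply ObjectProperty.hom_ext
    exact Hom.ext (Abelianization.hom_ext _ _ rfl)
  map_comp f g := by
    apply ObjectProperty.hom_ext
    exact Hom.ext (Abelianization.hom_ext _ _ rfl)

/-- The group of differences of the cone, i.e. the submonoid `{a * b⁻¹ | a, b ∈ P}`. For `G` abelian
it is the group completion of `P`. -/
def differences (G : PreOrdGrp.{u}) : Submonoid G where
  carrier := {x | ∃ a ∈ G.cone, ∃ b ∈ G.cone, x = a * b⁻¹}
  one_mem' := ⟨1, one_mem _, 1, one_mem _, by simp⟩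
  mul_mem' := by
    rintro _ _ ⟨a, ha, b, hb, rfl⟩ ⟨c, hc, d, hd, rfl⟩
    refine ⟨a * (b⁻¹ * c * b⁻¹⁻¹), mul_mem ha (G.conj_mem _ hc), d * b, mul_mem hd hb, ?_⟩
    group

/-- The preordered group `(G, grp(P))`. -/
def completeCone (G : PreOrdGrp.{u}) : PreOrdGrp.{u} where
  carrier := G
  cone := G.differences
  conj_mem := by
    rintro g _ ⟨a, ha, b, hb, rfl⟩
    exact ⟨_, G.conj_mem g ha, _, G.conj_mem g hb, by group⟩

/-- The functor `A`, sending `(G, P)` to `(G, grp(P))`. -/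
def functorA : PreOrdAb.{u} ⥤ MonoAb.{u} where
  obj G := ⟨completeCone G.obj, G.property, by
    rintro _ ⟨a, ha, b, hb, rfl⟩
    exact ⟨b, hb, a, ha,
      (mul_inv_rev (G := G.obj) a b⁻¹).trans (congrArg (· * a⁻¹) (inv_inv b))⟩⟩
  map {G H} f := ObjectProperty.homMk ⟨f.hom.hom, by
    rintro _ ⟨a, ha, b, hb, rfl⟩
    exact ⟨_, f.hom.map_cone ha, _, f.hom.map_cone hb, (map_mul f.hom.hom a b⁻¹).trans
      (congrArg (f.hom.hom a * ·) (map_inv f.hom.hom b))⟩⟩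

/-- A preordered abelian group, as a commutative group. -/
@[reducible] def commGroup (G : PreOrdAb.{u}) : CommGroup G.obj :=
  { G.obj.group with mul_comm := G.property }

/-- The adjunction `C ⊣ V`. -/
def adjC : functorC.{u} ⊣ functorV.{u} :=
  Adjunction.mkOfUnitCounit
    { unit := { app := fun G => ⟨Abelianization.of, fun {x} hx => ⟨x, hx, rfl⟩⟩ }
      counit :=
        { app := fun G => ObjectProperty.homMk
            ⟨letI := commGroup G; Abelianization.lift (MonoidHom.id G.obj), by
              rintro _ ⟨x, hx, rfl⟩
              exact hx⟩
          naturality := fun G H f => by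
            apply ObjectProperty.hom_ext
            exact Hom.ext (Abelianization.hom_ext _ _ rfl) }
      left_triangle := by
        apply NatTrans.ext
        funext G
        apply ObjectProperty.hom_ext
        exact Hom.ext (Abelianization.hom_ext _ _ rfl)
      right_triangle := rfl }

/-- The adjunction `A ⊣ W`. -/
def adjA : functorA.{u} ⊣ functorW.{u} :=
  Adjunction.mkOfUnitCounit
    { unit :=
        { app := fun G => ObjectProperty.homMk
            ⟨MonoidHom.id G.obj, fun {x} hx => ⟨x, hx, 1, one_mem _, by
              rw [inv_one, mul_one]; rfl⟩⟩ }
      counit :=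
        { app := fun G => ObjectProperty.homMk ⟨MonoidHom.id G.obj, by
            rintro _ ⟨a, ha, b, hb, rfl⟩
            exact mul_mem ha (G.property.2 b hb)⟩ }
      left_triangle := rfl
      right_triangle := rfl }

/-- The reflector `F = A ∘ C`. -/
def functorF : PreOrdGrp.{u} ⥤ MonoAb.{u} := functorC ⋙ functorA

/-- The inclusion `U` of `Mono(Ab)` in preordered groups. -/
def functorU : MonoAb.{u} ⥤ PreOrdGrp.{u} := functorW ⋙ functorV

/-- The adjunction `F ⊣ U`, composite of `C ⊣ V` and `A ⊣ W`. -/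
def adjF : functorF.{u} ⊣ functorU.{u} := adjC.comp adjA

/-- The unit of `F ⊣ U` is the quotient map `G → G/[G,G]`. -/
theorem adjF_unit_apply (G : PreOrdGrp.{u}) (x : G) :
    (adjF.unit.app G).hom x = Abelianization.of x := rfl

instance : functorU.{u}.Full := inferInstanceAs (functorW ⋙ functorV).Full

instance : functorU.{u}.Faithful := inferInstanceAs (functorW ⋙ functorV).Faithful

instance : HasPullbacks MonoAb.{u} :=
  letI : Reflective functorU.{u} := { L := functorF, adj := adjF }
  hasLimitsOfShape_of_reflective functorU

/-! ### The Galois structure -/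

theorem isRegularEpi_monoAb_iff {X Y : MonoAb.{u}} (f : X ⟶ Y) :
    IsRegularEpi f ↔ IsSurj (functorU.map f) := by
  constructor
  · rintro ⟨⟨r⟩⟩
    have : Epi f := RegularEpi.epi f r
    let I : MonoAb.{u} := ⟨im f.hom, by
      refine ⟨?_, ?_⟩
      · rintro ⟨_, x, rfl⟩ ⟨_, y, rfl⟩
        refine Subtype.ext ?_
        change f.hom.hom x * f.hom.hom y = f.hom.hom y * f.hom.hom x
        rw [← map_mul, X.property.1, map_mul]
      · rintro _ ⟨x, hx, rfl⟩
        exact ⟨x⁻¹, X.property.2 x hx, map_inv _ _⟩⟩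
    let e : X ⟶ I := ObjectProperty.homMk (toIm f.hom)
    have w : r.left ≫ e = r.right ≫ e := by
      apply ObjectProperty.hom_ext
      exact ofIm_cancel f.hom (congrArg InducedCategory.Hom.hom r.w)
    let d : Y ⟶ I := r.isColimit.desc (Cofork.ofπ e w)
    have hd : f ≫ d = e := r.isColimit.fac (Cofork.ofπ e w) WalkingParallelPair.one
    have hs : d ≫ (ObjectProperty.homMk (ofIm f.hom) : I ⟶ Y) = 𝟙 Y := by
      refine (cancel_epi f).1 ?_
      rw [← Category.assoc, hd, Category.comp_id]
      rfl
    exact isSurj_of_section d.hom (congrArg InducedCategory.Hom.hom hs)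
  · intro hf
    let K : MonoAb.{u} := ⟨pb f.hom f.hom, by
      refine ⟨?_, ?_⟩
      · rintro ⟨⟨a, b⟩, h⟩ ⟨⟨c, d⟩, h'⟩
        exact Subtype.ext (Prod.ext (X.property.1 a c) (X.property.1 b d))
      · rintro ⟨⟨a, b⟩, h⟩ ⟨ha, hb⟩
        exact ⟨X.property.2 a ha, X.property.2 b hb⟩⟩
    have key : ∀ s : Cofork (ObjectProperty.homMk (pbFst f.hom f.hom) : K ⟶ X)
        (ObjectProperty.homMk (pbSnd f.hom f.hom) : K ⟶ X), ∃ d : Y ⟶ s.pt, f ≫ d = s.π := by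
      intro s
      obtain ⟨d, hd⟩ := IsSurj.exists_desc hf s.π.hom
        (congrArg InducedCategory.Hom.hom s.condition)
      exact ⟨ObjectProperty.homMk d, ObjectProperty.hom_ext _ hd⟩
    exact ⟨⟨{ W := K
              left := ObjectProperty.homMk (pbFst f.hom f.hom)
              right := ObjectProperty.homMk (pbSnd f.hom f.hom)
              w := ObjectProperty.hom_ext _ (pb_condition f.hom f.hom)
              isColimit := Cofork.IsColimit.mk _
                (fun s => (key s).choose) (fun s => (key s).choose_spec)
                (fun s m hm => ObjectProperty.hom_ext _ (IsSurj.cancel hf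
                  (congrArg InducedCategory.Hom.hom
                    (hm.trans (key s).choose_spec.symm)))) }⟩⟩

theorem IsSurj.map_functorF {f : G ⟶ H} (hf : IsSurj f) :
    IsSurj (functorU.map (functorF.map f)) := by
  refine ⟨fun y => ?_, ?_⟩
  · obtain ⟨y, rfl⟩ := QuotientGroup.mk_surjective y
    obtain ⟨x, rfl⟩ := hf.1 y
    exact ⟨Abelianization.of x, rfl⟩
  · rintro _ ⟨_, ⟨a, ha, rfl⟩, _, ⟨b, hb, rfl⟩, rfl⟩
    obtain ⟨a, ha', rfl⟩ := hf.2 a ha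
    obtain ⟨b, hb', rfl⟩ := hf.2 b hb
    exact ⟨(Abelianization.of a * (Abelianization.of b)⁻¹ : Abelianization G),
      ⟨_, ⟨a, ha', rfl⟩, _, ⟨b, hb', rfl⟩, rfl⟩,
      (map_mul (Abelianization.map f.hom) _ _).trans
        (congrArg _ (map_inv (Abelianization.map f.hom) _))⟩

/-- The Galois structure `Γ` of the reflection `F ⊣ U` of preordered groups onto `Mono(Ab)`, with
regular epimorphisms as extensions on both sides. -/
def galoisStructure : GaloisStructure PreOrdGrp.{u} MonoAb.{u} where
  left := functorF
  right := functorU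
  adj := adjF
  E := MorphismProperty.regularEpi _
  Z := MorphismProperty.regularEpi _
  hasPullbacksAlong_E _ _ _ _ := inferInstance
  hasPullbacksAlong_Z _ _ _ _ := inferInstance
  comp_E := ⟨fun f g hf hg =>
    (isRegularEpi_iff _).2 (((isRegularEpi_iff f).1 hf).comp ((isRegularEpi_iff g).1 hg))⟩
  comp_Z := ⟨fun f g hf hg => (isRegularEpi_monoAb_iff _).2 <| by
    rw [Functor.map_comp]
    exact ((isRegularEpi_monoAb_iff f).1 hf).comp ((isRegularEpi_monoAb_iff g).1 hg)⟩
  iso_E _ _ f (_ : IsIso f) := (isRegularEpi_iff f).2 (isSurj_of_isIso f)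
  iso_Z _ _ f (_ : IsIso f) := (isRegularEpi_monoAb_iff f).2 (isSurj_of_isIso _)
  baseChange_E := ⟨fun sq hg =>
    (isRegularEpi_iff _).2 (IsSurj.of_isPullback sq ((isRegularEpi_iff _).1 hg))⟩
  baseChange_Z := ⟨fun sq hg => by
    have : PreservesLimits functorU.{u} := adjF.rightAdjoint_preservesLimits
    exact (isRegularEpi_monoAb_iff _).2
      (IsSurj.of_isPullback (sq.map functorU) ((isRegularEpi_monoAb_iff _).1 hg))⟩
  left_map _ _ f hf := (isRegularEpi_monoAb_iff _).2 ((isRegularEpi_iff f).1 hf).map_functorF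
  right_map _ _ f hf := (isRegularEpi_iff _).2 ((isRegularEpi_monoAb_iff f).1 hf)

end PreOrdGrp

namespace PreOrdGrp

variable {G H K P : PreOrdGrp.{u}}

open scoped commutatorElement

/-! ### Elementwise description of isomorphisms and pullbacks -/

/-! Regular epimorphisms are the morphisms surjective both on groups and on cones, and all of them
are effective for descent: pulling back along one reflects isomorphisms and preserves reflexive
coequalizers, so the monadicity theorem applies (`IsSurj.isEffectiveDescentMorphism`). Normality is
thus only a condition on the kernel pair, and a normal extension is central by taking itself as `p`.

The unit is abelianization, so triviality of `g : X ⟶ Y` means two things: `g` is injective on `[X,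
X]`, and `x` is positive once `g x` is positive and the class of `x` is a difference of positive
classes.

If `Ker f` is central, `(x, y) ↦ y * x⁻¹` is a homomorphism from the kernel pair to an abelian
group, hence kills commutators; special homogeneity makes this quotient positive on pairs of
positive elements (`isTrivialExtension_pbFst`). Conversely, triviality of a pullback of `f` is
tested on two elements: a commutator with an element over `1` gives centrality, and a quotient of
two positive elements over the same point gives homogeneity. -/

theorem isIso_of_bijective (f : G ⟶ H) (hf : Function.Bijective f.hom)
    (hc : ∀ x, f.hom x ∈ H.cone → x ∈ G.cone) : IsIso f := by
  let e : G ≃* H := MulEquiv.ofBijective f.hom hf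
  have he : ∀ y, f.hom (e.symm y) = y := e.apply_symm_apply
  exact ⟨⟨⟨e.symm.toMonoidHom, fun {y} hy => hc _ (by
    change f.hom (e.symm y) ∈ _
    rwa [he])⟩, hom_ext' fun x => e.symm_apply_apply x, hom_ext' he⟩⟩

section IsPullback

variable {p : P ⟶ G} {q : P ⟶ H} {f : G ⟶ K} {g : H ⟶ K}

/-- Descent and centrality involve pullbacks known only up to isomorphism; the comparison with `pb f
g` lets them be handled as sets of pairs, cones included. -/
theorem exists_of_isPullback (sq : IsPullback p q f g) {x : G} {y : H} (h : f.hom x = g.hom y) :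
    ∃ z, p.hom z = x ∧ q.hom z = y ∧ (x ∈ G.cone → y ∈ H.cone → z ∈ P.cone) := by
  let i := (sq.isoIsPullback _ _ (isPullback_pb f g)).inv
  have hp : i ≫ p = pbFst f g := sq.isoIsPullback_inv_fst _ _ _
  have hq : i ≫ q = pbSnd f g := sq.isoIsPullback_inv_snd _ _ _
  exact ⟨i.hom (⟨(x, y), h⟩ : pb f g), congr_hom hp _, congr_hom hq _,
    fun hx hy => i.map_cone (x := (⟨(x, y), h⟩ : pb f g)) ⟨hx, hy⟩⟩

theorem ext_of_isPullback (sq : IsPullback p q f g) {z w : P} (h₁ : p.hom z = p.hom w)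
    (h₂ : q.hom z = q.hom w) : z = w := by
  let e := sq.isoIsPullback _ _ (isPullback_pb f g)
  have hp : e.hom ≫ pbFst f g = p := sq.isoIsPullback_hom_fst _ _ _
  have hq : e.hom ≫ pbSnd f g = q := sq.isoIsPullback_hom_snd _ _ _
  have h : e.hom.hom z = e.hom.hom w := Subtype.ext (Prod.ext
    ((congr_hom hp z).trans (h₁.trans (congr_hom hp w).symm))
    ((congr_hom hq z).trans (h₂.trans (congr_hom hq w).symm)))
  have hi := congr_hom e.hom_inv_id
  exact (hi z).symm.trans ((congrArg e.inv.hom h).trans (hi w))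

theorem mem_cone_of_isPullback (sq : IsPullback p q f g) {z : P} (h₁ : p.hom z ∈ G.cone)
    (h₂ : q.hom z ∈ H.cone) : z ∈ P.cone := by
  obtain ⟨w, hp, hq, hw⟩ := exists_of_isPullback sq (congr_hom sq.w z)
  rw [← ext_of_isPullback sq hp hq]
  exact hw h₁ h₂

theorem isPullback_of_elements (w : p ≫ f = q ≫ g)
    (hinj : ∀ z, p.hom z = 1 → q.hom z = 1 → z = 1)
    (hsurj : ∀ x y, f.hom x = g.hom y → ∃ z, p.hom z = x ∧ q.hom z = y)
    (hc : ∀ z, p.hom z ∈ G.cone → q.hom z ∈ H.cone → z ∈ P.cone) : IsPullback p q f g := by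
  have : IsIso (pbLift f g p q w) := by
    refine isIso_of_bijective _ ⟨?_, ?_⟩ fun z hz => hc z hz.1 hz.2
    · refine (injective_iff_map_eq_one _).2 fun z hz => hinj z ?_ ?_
      · exact congrArg (fun t => t.1.1) hz
      · exact congrArg (fun t => t.1.2) hz
    · rintro ⟨⟨x, y⟩, h⟩
      obtain ⟨z, rfl, rfl⟩ := hsurj x y h
      exact ⟨z, rfl⟩
  exact IsPullback.of_iso (isPullback_pb f g) (asIso (pbLift f g p q w)).symm (Iso.refl _)
    (Iso.refl _) (Iso.refl _) (by rw [Iso.symm_hom, Iso.eq_inv_comp]; rfl)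
    (by rw [Iso.symm_hom, Iso.eq_inv_comp]; rfl) (by simp) (by simp)

end IsPullback

/-! ### Regular epimorphisms are effective for descent -/

/-- The quotient of a preordered group by a normal subgroup, with the image of the cone. -/
def quotient (G : PreOrdGrp.{u}) (N : Subgroup G) [N.Normal] : PreOrdGrp.{u} where
  carrier := G ⧸ N
  cone := G.cone.map (QuotientGroup.mk' N)
  conj_mem := by
    rintro g _ ⟨x, hx, rfl⟩
    obtain ⟨g, rfl⟩ := QuotientGroup.mk_surjective g
    exact ⟨g * x * g⁻¹, G.conj_mem g hx, rfl⟩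

/-- The quotient map. -/
def toQuotient (G : PreOrdGrp.{u}) (N : Subgroup G) [N.Normal] : G ⟶ G.quotient N :=
  ⟨QuotientGroup.mk' N, fun {x} hx => ⟨x, hx, rfl⟩⟩

theorem isSurj_toQuotient (N : Subgroup G) [N.Normal] : IsSurj (G.toQuotient N) :=
  ⟨QuotientGroup.mk_surjective, fun _ ⟨x, hx, e⟩ => ⟨x, hx, e⟩⟩

/-- `q` coequalizes `u` and `v` and its kernel is the normalization of the pair. -/
def IsReflexiveQuotient {X Y Z : PreOrdGrp.{u}} (a b : X ⟶ Y) (q : Y ⟶ Z) : Prop :=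
  IsSurj q ∧ ∀ y, q.hom y = 1 → ∃ x, b.hom x = 1 ∧ a.hom x = y

theorem IsReflexiveQuotient.exists_desc {X Y Z : PreOrdGrp.{u}} {a b : X ⟶ Y} {q : Y ⟶ Z}
    (hq : IsReflexiveQuotient a b q) (k : Y ⟶ K) (h : a ≫ k = b ≫ k) :
    ∃ d : Z ⟶ K, q ≫ d = k := by
  refine hq.1.exists_desc k (hom_ext' ?_)
  rintro ⟨⟨y₁, y₂⟩, e⟩
  change k.hom y₁ = k.hom y₂
  -- Two elements with the same image differ by some `a x` with `b x = 1`, and `k` cannot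
  -- distinguish `a x` from `b x`.
  obtain ⟨x, hx, hy⟩ := hq.2 (y₁ * y₂⁻¹) (by
    rw [map_mul, map_inv, mul_inv_eq_one]
    exact e)
  have := congr_hom h x
  rw [comp_apply, comp_apply, hx, hy, map_one, map_mul, map_inv, mul_inv_eq_one] at this
  exact this

/-- A quotient by the normalization of a pair is a coequalizer in the slice category. -/
noncomputable def IsReflexiveQuotient.isColimit {X Y Z : Over K} {a b : X ⟶ Y} {q : Y ⟶ Z}
    (hq : IsReflexiveQuotient a.left b.left q.left) (w : a ≫ q = b ≫ q) :
    IsColimit (Cofork.ofπ q w) :=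
  have key : ∀ s : Cofork a b, ∃ d : Z ⟶ s.pt, q ≫ d = s.π := fun s => by
    obtain ⟨d, hd⟩ := hq.exists_desc s.π.left (congrArg CommaMorphism.left s.condition)
    refine ⟨Over.homMk d (hq.1.cancel ?_), Over.OverMorphism.ext hd⟩
    rw [← Category.assoc, hd, Over.w, Over.w]
  Cofork.IsColimit.mk _ (fun s => (key s).choose) (fun s => (key s).choose_spec)
    (fun s m hm => Over.OverMorphism.ext (hq.1.cancel
      (congrArg CommaMorphism.left (hm.trans (key s).choose_spec.symm))))

theorem exists_isReflexiveQuotient {X Y : Over K} (a b : X ⟶ Y) [IsReflexivePair a b] :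
    ∃ (Z : Over K) (q : Y ⟶ Z), a ≫ q = b ≫ q ∧
      IsReflexiveQuotient a.left b.left q.left := by
  obtain ⟨s, ha, hb⟩ := IsReflexivePair.common_section a b
  replace ha : ∀ y, a.left.hom (s.left.hom y) = y := congr_hom (congrArg CommaMorphism.left ha)
  replace hb : ∀ y, b.left.hom (s.left.hom y) = y := congr_hom (congrArg CommaMorphism.left hb)
  -- The common section makes `a (Ker b)` normal: conjugation by `y` lifts to conjugation by `s y`,
  -- which preserves `Ker b`.
  let N : Subgroup Y.left := b.left.hom.ker.map a.left.hom
  have : N.Normal := ⟨by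
    rintro _ ⟨x, hx, rfl⟩ y
    have hx' : b.left.hom x = 1 := hx
    refine ⟨s.left.hom y * x * (s.left.hom y)⁻¹, ?_, ?_⟩
    · change b.left.hom _ = 1
      rw [map_mul, map_mul, map_inv, hx', mul_one, mul_inv_cancel]
    · rw [map_mul, map_mul, map_inv, ha]⟩
  have hN : IsReflexiveQuotient a.left b.left (Y.left.toQuotient N) :=
    ⟨isSurj_toQuotient N, fun y hy => (QuotientGroup.eq_one_iff y).1 hy⟩
  obtain ⟨d, hd⟩ := hN.exists_desc Y.hom (by rw [Over.w, Over.w])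
  refine ⟨Over.mk d, Over.homMk (Y.left.toQuotient N) hd, ?_, hN⟩
  refine Over.OverMorphism.ext (hom_ext' fun x => QuotientGroup.eq_iff_div_mem.2 ?_)
  -- Reflexivity again: this element is in `Ker b`, and `a` sends it to `a x * (b x)⁻¹`.
  refine ⟨x * (s.left.hom (b.left.hom x))⁻¹, ?_, ?_⟩
  · change b.left.hom _ = 1
    rw [map_mul, map_inv, hb, mul_inv_cancel]
  · rw [map_mul, map_inv, ha, div_eq_mul_inv]

theorem pullback_map_fst {p : G ⟶ H} {X Y : Over H} (a : X ⟶ Y)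
    (z : (pullback X.hom p : PreOrdGrp.{u})) :
    (pullback.fst Y.hom p).hom (((Over.pullback p).map a).left.hom z) =
      a.left.hom ((pullback.fst X.hom p).hom z) :=
  congr_hom (show ((Over.pullback p).map a).left ≫ pullback.fst Y.hom p =
    pullback.fst X.hom p ≫ a.left from pullback.lift_fst _ _ _) z

theorem pullback_map_snd {p : G ⟶ H} {X Y : Over H} (a : X ⟶ Y)
    (z : (pullback X.hom p : PreOrdGrp.{u})) :
    (pullback.snd Y.hom p).hom (((Over.pullback p).map a).left.hom z) =
      (pullback.snd X.hom p).hom z :=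
  congr_hom (show ((Over.pullback p).map a).left ≫ pullback.snd Y.hom p =
    pullback.snd X.hom p from pullback.lift_snd _ _ _) z

/-- The kernel of the pulled-back quotient consists of pairs `(y, 1)`. A witness `x` for `y` lies
over `1` because `b x = 1`, so `(x, 1)` is a witness upstairs. No surjectivity of `p` is needed. -/
theorem IsReflexiveQuotient.pullback (p : G ⟶ H) {X Y Z : Over H} {a b : X ⟶ Y} {q : Y ⟶ Z}
    (hq : IsReflexiveQuotient a.left b.left q.left) :
    IsReflexiveQuotient ((Over.pullback p).map a).left ((Over.pullback p).map b).left
      ((Over.pullback p).map q).left := by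
  have hw : ∀ {X Y : Over H} (a : X ⟶ Y) (x : X.left), Y.hom.hom (a.left.hom x) = X.hom.hom x :=
    fun a => congr_hom (Over.w a)
  have sq : ∀ X : Over H, IsPullback (pullback.fst X.hom p) (pullback.snd X.hom p) X.hom p :=
    fun X => IsPullback.of_hasPullback _ _
  have hsq : ∀ (X : Over H) (z : (Limits.pullback X.hom p : PreOrdGrp.{u})),
      X.hom.hom ((pullback.fst X.hom p).hom z) = p.hom ((pullback.snd X.hom p).hom z) :=
    fun X => congr_hom (sq X).w
  refine ⟨⟨fun z => ?_, fun z hz => ?_⟩, fun y hy => ?_⟩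
  · obtain ⟨y, hy⟩ := hq.1.1 ((pullback.fst Z.hom p).hom z)
    obtain ⟨t, h₁, h₂, -⟩ := exists_of_isPullback (sq Y) (x := y)
      (y := (pullback.snd Z.hom p).hom z) (by rw [← hw q, hy, hsq])
    exact ⟨t, ext_of_isPullback (sq Z) (by rw [pullback_map_fst, h₁, hy])
      (by rw [pullback_map_snd, h₂])⟩
  · obtain ⟨y, hyc, hy⟩ := hq.1.2 ((pullback.fst Z.hom p).hom z) (Hom.map_cone _ hz)
    obtain ⟨t, h₁, h₂, ht⟩ := exists_of_isPullback (sq Y) (x := y)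
      (y := (pullback.snd Z.hom p).hom z) (by rw [← hw q, hy, hsq])
    exact ⟨t, ht hyc (Hom.map_cone _ hz), ext_of_isPullback (sq Z)
      (by rw [pullback_map_fst, h₁, hy]) (by rw [pullback_map_snd, h₂])⟩
  · have hs : (pullback.snd Y.hom p).hom y = 1 := by
      rw [← pullback_map_snd q, hy, map_one]
    obtain ⟨x, hx, e⟩ := hq.2 ((pullback.fst Y.hom p).hom y)
      (by rw [← pullback_map_fst q, hy, map_one])
    obtain ⟨t, h₁, h₂, -⟩ := exists_of_isPullback (sq X) (x := x) (y := 1)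
      (by rw [← hw b, hx, map_one, map_one])
    exact ⟨t, ext_of_isPullback (sq Y) (by rw [pullback_map_fst, h₁, hx, map_one])
      (by rw [pullback_map_snd, h₂, map_one]),
      ext_of_isPullback (sq Y) (by rw [pullback_map_fst, h₁, e])
      (by rw [pullback_map_snd, h₂, hs])⟩

instance hasReflexiveCoequalizers_over : HasReflexiveCoequalizers (Over K) :=
  ⟨fun _ _ a b _ => by
    obtain ⟨Z, q, w, hq⟩ := exists_isReflexiveQuotient a b
    exact ⟨⟨_, hq.isColimit w⟩⟩⟩

theorem preservesReflexiveCoequalizers_pullback (p : G ⟶ H) :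
    Monad.PreservesColimitOfIsReflexivePair (Over.pullback p) :=
  ⟨fun {X Y} a b _ => by
    obtain ⟨Z, q, w, hq⟩ := exists_isReflexiveQuotient a b
    exact preservesColimit_of_preserves_colimit_cocone (hq.isColimit w)
      ((isColimitMapCoconeCoforkEquiv _ w).symm ((hq.pullback p).isColimit _))⟩

/-- The kernel of `a` lies over `1`, so it already embeds in the pullback. Surjectivity of `p` on
groups gives surjectivity of `a`; surjectivity on cones gives reflection of positivity. -/
theorem IsSurj.reflectsIsomorphisms_pullback {p : G ⟶ H} (hp : IsSurj p) :
    (Over.pullback p).ReflectsIsomorphisms := by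
  refine ⟨fun {X Y} a _ => ?_⟩
  have : IsIso ((Over.pullback p).map a).left :=
    inferInstanceAs (IsIso ((Over.forget G).map ((Over.pullback p).map a)))
  have hi := isSurj_of_isIso ((Over.pullback p).map a).left
  have hinj : Function.Injective ((Over.pullback p).map a).left.hom :=
    Function.LeftInverse.injective (congr_hom (IsIso.hom_inv_id ((Over.pullback p).map a).left))
  have hw : ∀ x : X.left, Y.hom.hom (a.left.hom x) = X.hom.hom x := congr_hom (Over.w a)
  have sq : ∀ X : Over H, IsPullback (pullback.fst X.hom p) (pullback.snd X.hom p) X.hom p :=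
    fun X => IsPullback.of_hasPullback _ _
  have hainj : Function.Injective a.left.hom := by
    refine (injective_iff_map_eq_one _).2 fun x hx => ?_
    obtain ⟨z, h₁, h₂, -⟩ := exists_of_isPullback (sq X) (x := x) (y := 1)
      (by rw [← hw, hx, map_one, map_one])
    have hz : z = 1 := hinj (ext_of_isPullback (sq Y)
      (by rw [pullback_map_fst, h₁, hx, map_one, map_one])
      (by rw [pullback_map_snd, h₂, map_one, map_one]))
    rw [← h₁, hz, map_one]
  have : IsIso a.left := by
    refine isIso_of_bijective _ ⟨hainj, fun y => ?_⟩ fun x hx => ?_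
    · obtain ⟨e, he⟩ := hp.1 (Y.hom.hom y)
      obtain ⟨z, h₁, -, -⟩ := exists_of_isPullback (sq Y) he.symm
      obtain ⟨t, rfl⟩ := hi.1 z
      exact ⟨_, (pullback_map_fst a t).symm.trans h₁⟩
    · obtain ⟨e, hec, he⟩ := hp.2 _ (Y.hom.map_cone hx)
      obtain ⟨z, h₁, -, hz⟩ := exists_of_isPullback (sq Y) he.symm
      obtain ⟨t, htc, rfl⟩ := hi.2 z (hz hx hec)
      rw [← hainj ((pullback_map_fst a t).symm.trans h₁)]
      exact Hom.map_cone _ htc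
  have : IsIso ((Over.forget H).map a) := this
  exact isIso_of_reflects_iso a (Over.forget H)

/-- Regular epimorphisms of preordered groups are effective descent morphisms. -/
theorem IsSurj.isEffectiveDescentMorphism {p : G ⟶ H} (hp : IsSurj p) :
    IsEffectiveDescentMorphism p :=
  have := hp.reflectsIsomorphisms_pullback
  have := preservesReflexiveCoequalizers_pullback p
  ⟨inferInstance, ⟨Monad.monadicOfHasPreservesReflexiveCoequalizersOfReflectsIsomorphisms
    (Over.mapPullbackAdj p)⟩⟩

/-! ### Trivial extensions -/

theorem isTrivialExtension_of_isSurj {f : G ⟶ H} (hf : IsSurj f)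
    (hcomm : ∀ x ∈ commutator G, f.hom x = 1 → x = 1)
    (hc : ∀ x, f.hom x ∈ H.cone → ∀ a ∈ G.cone, ∀ b ∈ G.cone,
      (a * b⁻¹)⁻¹ * x ∈ commutator G → x ∈ G.cone) :
    galoisStructure.{u}.IsTrivialExtension f := by
  refine ⟨(isRegularEpi_iff f).2 hf, ?_⟩
  refine isPullback_of_elements (adjF.unit.naturality f).symm (fun x h₁ h₂ => ?_)
    (fun x y h => ?_) fun x h₁ h₂ => ?_
  · exact hcomm x (by rw [← Abelianization.ker_of]; exact h₁) h₂
  · obtain ⟨x, rfl⟩ := QuotientGroup.mk_surjective x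
    obtain ⟨z, rfl⟩ := hf.1 y
    have h' : Abelianization.of (f.hom x) = Abelianization.of (f.hom z) := h
    -- A surjection maps `[G, G]` onto `[H, H]`, so a representative of the class can be corrected
    -- by a commutator element `c` without changing the class.
    have hmem : (f.hom x)⁻¹ * f.hom z ∈ (commutator G).map f.hom := by
      rw [commutator_def, Subgroup.map_commutator, ← MonoidHom.range_eq_map,
        MonoidHom.range_eq_top.2 hf.1, ← commutator_def]
      exact QuotientGroup.eq.1 h'
    obtain ⟨c, hcm, e⟩ := hmem
    refine ⟨x * c, ?_, ?_⟩
    · exact QuotientGroup.mk_mul_of_mem x hcm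
    · rw [map_mul, e, mul_inv_cancel_left]
  · obtain ⟨_, ⟨a, ha, rfl⟩, _, ⟨b, hb, rfl⟩, e⟩ := h₁
    refine hc x h₂ a ha b hb (QuotientGroup.eq.1 ?_)
    exact Eq.symm e

theorem eq_one_of_isTrivialExtension {f : G ⟶ H} (hf : galoisStructure.{u}.IsTrivialExtension f)
    {x : G} (h : x ∈ commutator G) (hx : f.hom x = 1) : x = 1 := by
  rw [← Abelianization.ker_of] at h
  refine ext_of_isPullback hf.2 ?_ ?_
  · rw [map_one]
    exact h
  · rw [hx, map_one]

/-- The unit sends a difference of positive elements into the completed cone, so both coordinates in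
the pullback are positive. -/
theorem mem_cone_of_isTrivialExtension {f : G ⟶ H}
    (hf : galoisStructure.{u}.IsTrivialExtension f) {x : G} (h : x ∈ G.differences)
    (hx : f.hom x ∈ H.cone) : x ∈ G.cone := by
  refine mem_cone_of_isPullback hf.2 ?_ hx
  obtain ⟨a, ha, b, hb, rfl⟩ := h
  exact ⟨Abelianization.of a, ⟨a, ha, rfl⟩, Abelianization.of b, ⟨b, hb, rfl⟩,
    map_mul Abelianization.of a b⁻¹⟩

/-! ### Normal and central extensions -/

/-- Elements of the cone in the same fibre of a special homogeneous surjection differ by a positive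
element of the kernel. -/
theorem mul_inv_mem_cone {f : G ⟶ H} (hs : IsSpecialHomogeneousSurjection (Hom.coneMap f))
    {x y : G} (hx : x ∈ G.cone) (hy : y ∈ G.cone) (h : f.hom x = f.hom y) :
    y * x⁻¹ ∈ G.cone := by
  -- The pair `(x, y)` is in the fibre over `x`, hence equals `k * (x, x)`; its second coordinate
  -- exhibits `y * x⁻¹` as an element of the cone.
  obtain ⟨k, hk, e⟩ := (hs.2.bijOn_mul_right ⟨x, hx⟩).surjOn
    (show (⟨(⟨x, hx⟩, ⟨y, hy⟩), Subtype.ext h⟩ : monoidKernelPair (Hom.coneMap f)) ∈ _ from rfl)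
  have e₂ : (k.1.2 : G) * x = y := congrArg (fun t => (t.1.2 : G)) e
  rw [← e₂, mul_inv_cancel_right]
  exact k.1.2.2

/-- Centrality supplies a homomorphism `δ` measuring the gap between the two coordinates. Elements
congruent modulo commutators have the same gap, so that of `(x, y)` is computed from the pairs `(a,
a')` and `(b, b')`, where homogeneity applies. -/
theorem isTrivialExtension_pbFst {f : G ⟶ H} (hf : IsSurj f)
    (hZ : f.hom.ker ≤ Subgroup.center G)
    (hs : IsSpecialHomogeneousSurjection (Hom.coneMap f)) :
    galoisStructure.{u}.IsTrivialExtension (pbFst f f) := by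
  have hcomm : ∀ z : pb f f, z ∈ commutator (pb f f) → z.1.1 = z.1.2 := by
    have central : ∀ z : pb f f, z.1.2 * z.1.1⁻¹ ∈ Subgroup.center G := fun z => hZ (by
      have hz : f.hom z.1.1 = f.hom z.1.2 := z.2
      rw [MonoidHom.mem_ker, map_mul, map_inv, hz, mul_inv_cancel])
    let _ : CommGroup (Subgroup.center G) :=
      { mul_comm := fun a b => Subtype.ext (Subgroup.mem_center_iff.1 b.2 a) }
    let δ : pb f f →* Subgroup.center G :=
      MonoidHom.mk' (fun z => ⟨z.1.2 * z.1.1⁻¹, central z⟩) fun z w => Subtype.ext (by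
        change z.1.2 * w.1.2 * (z.1.1 * w.1.1)⁻¹ = z.1.2 * z.1.1⁻¹ * (w.1.2 * w.1.1⁻¹)
        rw [mul_assoc z.1.2 z.1.1⁻¹, Subgroup.mem_center_iff.1 (central w), mul_inv_rev]
        simp only [mul_assoc])
    intro z hz
    have h : δ z = 1 := Abelianization.commutator_subset_ker δ hz
    exact (mul_inv_eq_one.1 (congrArg Subtype.val h)).symm
  refine isTrivialExtension_of_isSurj (hf.of_isPullback (isPullback_pb f f).flip) ?_ ?_
  · intro z hz h
    have h₁ : z.1.1 = 1 := h
    exact Subtype.ext (Prod.ext h₁ ((hcomm z hz).symm.trans h₁))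
  · rintro ⟨⟨x, y⟩, hxy⟩ hx ⟨⟨a, a'⟩, ha⟩ ⟨ha₁, ha₂⟩ ⟨⟨b, b'⟩, hb⟩ ⟨hb₁, hb₂⟩ hz
    have hx' : x ∈ G.cone := hx
    refine ⟨hx', ?_⟩
    change y ∈ G.cone
    have e : (a * b⁻¹)⁻¹ * x = (a' * b'⁻¹)⁻¹ * y := hcomm _ hz
    have hfb : f.hom b = f.hom b' := hb
    have hk := mul_inv_mem_cone hs ha₁ ha₂ ha
    have hl := mul_inv_mem_cone hs hb₂ hb₁ hb.symm
    have hc : b * b'⁻¹ ∈ Subgroup.center G := hZ (by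
      rw [MonoidHom.mem_ker, map_mul, map_inv, hfb, mul_inv_cancel])
    -- After moving the central factor `b'⁻¹ * b = b * b'⁻¹` to the front, `y` is the product of `b
    -- * b'⁻¹`, `a' * a⁻¹` and `x`, all positive.
    have hy : y = a' * (b'⁻¹ * b) * a⁻¹ * x := by
      rw [eq_inv_mul_iff_mul_eq] at e
      rw [← e]
      group
    have hc' : b'⁻¹ * b = b * b'⁻¹ := by
      rw [inv_mul_eq_iff_eq_mul, (Subgroup.mem_center_iff.1 hc b'), inv_mul_cancel_right]
    rw [hy, hc', Subgroup.mem_center_iff.1 hc a', mul_assoc (b * b'⁻¹)]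
    exact mul_mem (mul_mem hl hk) hx'

theorem IsSurj.isMonadicExtension {p : G ⟶ H} (hp : IsSurj p) :
    galoisStructure.{u}.IsMonadicExtension p :=
  ⟨(isRegularEpi_iff p).2 hp, hp.isEffectiveDescentMorphism⟩

/-- Injectivity on fibres is cancellation in the ambient group, and the only possible preimage has
second coordinate `y * x⁻¹` or `x⁻¹ * y`. So positivity of these quotients is the whole content, and
closure under conjugation passes from one to the other. -/
theorem isSpecialHomogeneousSurjection_coneMap {f : G ⟶ H} (hf : IsSurj f)
    (hd : ∀ x ∈ G.cone, ∀ y ∈ G.cone, f.hom x = f.hom y → y * x⁻¹ ∈ G.cone) :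
    IsSpecialHomogeneousSurjection (Hom.coneMap f) := by
  have hd' : ∀ x ∈ G.cone, ∀ y ∈ G.cone, f.hom x = f.hom y → x⁻¹ * y ∈ G.cone := by
    intro x hx y hy h
    have := G.conj_mem x⁻¹ (hd x hx y hy h)
    rwa [← mul_assoc, inv_inv, inv_mul_cancel_right] at this
  refine ⟨?_, fun _ => rfl, fun x => ⟨?_, ?_, ?_⟩, fun x => ⟨?_, ?_, ?_⟩⟩
  · rintro ⟨y, hy⟩
    obtain ⟨x, hx, e⟩ := hf.2 y hy
    exact ⟨⟨x, hx⟩, Subtype.ext e⟩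
  · intro k hk
    have hk' : k.1.1 = 1 := hk
    change k.1.1 * x = x
    rw [hk', one_mul]
  · intro k hk l hl h
    have hk' : k.1.1 = 1 := hk
    have hl' : l.1.1 = 1 := hl
    refine Subtype.ext (Prod.ext (hk'.trans hl'.symm) (Subtype.ext ?_))
    exact mul_right_cancel (congrArg (fun t => (t.1.2 : G)) h)
  · rintro ⟨⟨z, y⟩, h⟩ hz
    have hz' : z = x := hz
    subst hz'
    have h' : f.hom z = f.hom y := congrArg Subtype.val h
    refine ⟨⟨(1, ⟨(y : G) * (z : G)⁻¹, hd _ z.2 _ y.2 h'⟩), Subtype.ext ?_⟩, rfl, ?_⟩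
    · change f.hom 1 = f.hom ((y : G) * (z : G)⁻¹)
      rw [map_one, map_mul, map_inv, h', mul_inv_cancel]
    · exact Subtype.ext (Prod.ext (one_mul z) (Subtype.ext (inv_mul_cancel_right (y : G) z)))
  · intro k hk
    have hk' : k.1.1 = 1 := hk
    change x * k.1.1 = x
    rw [hk', mul_one]
  · intro k hk l hl h
    have hk' : k.1.1 = 1 := hk
    have hl' : l.1.1 = 1 := hl
    refine Subtype.ext (Prod.ext (hk'.trans hl'.symm) (Subtype.ext ?_))
    exact mul_left_cancel (congrArg (fun t => (t.1.2 : G)) h)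
  · rintro ⟨⟨z, y⟩, h⟩ hz
    have hz' : z = x := hz
    subst hz'
    have h' : f.hom z = f.hom y := congrArg Subtype.val h
    refine ⟨⟨(1, ⟨(z : G)⁻¹ * y, hd' _ z.2 _ y.2 h'⟩), Subtype.ext ?_⟩, rfl, ?_⟩
    · change f.hom 1 = f.hom ((z : G)⁻¹ * y)
      rw [map_one, map_mul, map_inv, h', inv_mul_cancel]
    · exact Subtype.ext (Prod.ext (mul_one z) (Subtype.ext (mul_inv_cancel_left (z : G) y)))

/-! ### Centrality and homogeneity detected after pullback -/

section Pullback

variable {E : PreOrdGrp.{u}} {f : G ⟶ H} {p : E ⟶ H} {π₁ : P ⟶ E} {π₂ : P ⟶ G}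

/-- Lift `k` to an element `w` over `1` and `g` to any `z`. Then `π₁` kills the commutator of `z`
and `w`, so triviality makes it `1`; projecting to `G` gives commutation. -/
theorem ker_le_center_of_isTrivialExtension (hp : IsSurj p) (sq : IsPullback π₂ π₁ f p)
    (ht : galoisStructure.{u}.IsTrivialExtension π₁) : f.hom.ker ≤ Subgroup.center G := by
  intro k hk
  refine Subgroup.mem_center_iff.2 fun g => ?_
  obtain ⟨e, he⟩ := hp.1 (f.hom g)
  obtain ⟨z, hz₂, -, -⟩ := exists_of_isPullback sq he.symm
  obtain ⟨w, hw₂, hw₁, -⟩ := exists_of_isPullback sq (x := k) (y := 1)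
    ((MonoidHom.mem_ker.1 hk).trans (map_one p.hom).symm)
  have h : ⁅z, w⁆ = 1 := eq_one_of_isTrivialExtension ht
    (Subgroup.commutator_mem_commutator (Subgroup.mem_top z) (Subgroup.mem_top w))
    (by rw [map_commutatorElement, hw₁, commutatorElement_one_right])
  have := congrArg π₂.hom h
  rwa [map_commutatorElement, hz₂, hw₂, map_one, commutatorElement_eq_one_iff_mul_comm] at this

theorem mul_inv_mem_cone_of_isTrivialExtension (hp : IsSurj p) (sq : IsPullback π₂ π₁ f p)
    (ht : galoisStructure.{u}.IsTrivialExtension π₁) {x y : G} (hx : x ∈ G.cone)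
    (hy : y ∈ G.cone) (h : f.hom x = f.hom y) : y * x⁻¹ ∈ G.cone := by
  -- Choosing `e` positive is what makes both lifts `(e, x)` and `(e, y)` positive; their quotient
  -- is then a difference lying over `1`, which is positive.
  obtain ⟨e, hec, he⟩ := hp.2 (f.hom x) (f.map_cone hx)
  obtain ⟨z, hz₂, hz₁, hz⟩ := exists_of_isPullback sq he.symm
  obtain ⟨w, hw₂, hw₁, hw⟩ := exists_of_isPullback sq (h.symm.trans he.symm)
  have := π₂.map_cone (mem_cone_of_isTrivialExtension ht
    ⟨w, hw hy hec, z, hz hx hec, rfl⟩ (by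
      rw [map_mul, map_inv, hw₁, hz₁, mul_inv_cancel]
      exact one_mem _))
  rwa [map_mul, map_inv, hw₂, hz₂] at this

end Pullback

end PreOrdGrp

open PreOrdGrp in
theorem theorem5p3 {G H : PreOrdGrp.{u}} (f : G ⟶ H) (hf : IsRegularEpi f) :
    List.TFAE
      [f.hom.ker ≤ Subgroup.center G ∧
          IsSpecialHomogeneousSurjection (PreOrdGrp.Hom.coneMap f),
        PreOrdGrp.galoisStructure.{u}.IsNormalExtension f,
        PreOrdGrp.galoisStructure.{u}.IsCentralExtension f] := by
  have hs : IsSurj f := (isRegularEpi_iff f).1 hf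
  tfae_have 1 → 2 := fun h =>
    ⟨hs.isMonadicExtension, _, _, _, (isPullback_pb f f).flip,
      isTrivialExtension_pbFst hs h.1 h.2⟩
  tfae_have 2 → 3 := fun ⟨hm, P, π₁, π₂, sq, ht⟩ => ⟨hf, _, f, hm, P, π₁, π₂, sq, ht⟩
  tfae_have 3 → 1 := by
    rintro ⟨-, E, p, hp, P, π₁, π₂, sq, ht⟩
    have hp' : IsSurj p := (isRegularEpi_iff p).1 hp.1
    exact ⟨ker_le_center_of_isTrivialExtension hp' sq ht,
      isSpecialHomogeneousSurjection_coneMap hs fun _ hx _ hy h =>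
        mul_inv_mem_cone_of_isTrivialExtension hp' sq ht hx hy h⟩
  tfae_finish
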